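/- Consider the following Markov decision process in discrete time, with parameters $0<p<1$, $0<q<1$ and a storage cost $c\ge 0$. A state is a triple $S=(v,\lambda,b)$, where $v\in\{1,2,3,\dots\}$ is the age of the user, $\lambda\in\{0,1\}$ indicates whether a fresh update packet is available at the base station, and $b\in\{0,1\}$ indicates whether the buffer holds an update packet. The actions are $a\in\{0,1\}$, where $a=1$ means that the available packet is stored. Given the state $(v,\lambda,b)$ and the action $a$ at time $t$, let $X$ (transmission success) and $\Lambda$ (next arrival) be Bernoulli variables with parameters $q$ and $p$, independent of each other and of the history up to time $t$ (including the action $a$). The state $(v',\lambda',b')$ at time $t+1$ is given by $\lambda'=\Lambda$, $b'=a\lambda$, and $$v'=\begin{cases}1 & \text{if }\lambda=1,\ X=1,\\ 2 & \text{if }\lambda=0,\ b=1,\ X=1,\\ v+1&\text{otherwise.}\end{cases}$$ A policy $\pi$ chooses the action $a^\pi(t)$, possibly at random, as a function of the states and actions before time $t$ and the state at time $t$; let $v^\pi(t)$ denote the age at time $t$ and put $c^\pi(t)=c\,a^\pi(t)$. A policy is (deterministic) stationary if $a^\pi(t)=f(S^\pi(t))$ for a fixed function $f$ from states to $\{0,1\}$.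 Then there exists a deterministic stationary policy, not depending on the law of the initial state, that is optimal: for every law of the initial state under which the age has finite mean (in particular, for every law under which the initial age is $1$), it minimizes $$\limsup_{T\to\infty}\frac1T\,\mathbb{E}_\pi\Big[\sum_{t=0}^{T-1}\big(v^\pi(t)+c^\pi(t)\big)\Big]$$ over all policies $\pi$, and the minimum is finite. -/

import Mathlib

open scoped ENNReal NNReal unitInterval

noncomputable section

namespace AgeStorage

/-- A state `(v, λ, b)`: the age `v ≥ 1` of the user, whether a fresh update packet is available
at the base station, and whether the buffer holds an update packet. -/
@[ext]
structure State where
  age : ℕ+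
  fresh : Bool
  buf : Bool

/-- The law of a Bernoulli variable: `true` with probability `p`, `false` with `1 - p`. -/
def coin (p : I) : PMF Bool :=
  PMF.ofFintype (fun b => bif b then ENNReal.ofReal p else ENNReal.ofReal (1 - p)) (by
    rw [Fintype.sum_bool, cond_true, cond_false,
      ← ENNReal.ofReal_add p.2.1 (sub_nonneg.2 p.2.2), add_sub_cancel, ENNReal.ofReal_one])

/-- The state in the next slot, from state `s`, under action `a` (`true`: store, `false`: do not
store), when `success` tells whether the channel lets a packet through in this slot and `arrival`
whether a fresh packet arrives in the next slot.  A fresh packet is transmitted if there is one,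
otherwise the buffered packet if there is one; a buffered packet is dropped after one slot. -/
def next (s : State) (a success arrival : Bool) : State where
  age :=
    if s.fresh then (if success then 1 else s.age + 1)
    else if s.buf && success then 2
    else s.age + 1
  fresh := arrival
  buf := s.fresh && a

/-- The transition probabilities `P_a(s, ·)`, with arrival probability `p` and transmission
success probability `q`. -/
def step (p q : I) (s : State) (a : Bool) : PMF State :=
  (coin q).bind fun success => (coin p).map fun arrival => next s a success arrival

/-- A causal (history dependent, possibly randomized) policy: given the list of past
state-action pairs (most recent first; its length is the current time) and the current state,
the law of the current action. -/
abbrev Policy : Type := List (State × Bool) → State → PMF Bool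

/-- The (deterministic) stationary policy that takes action `f s` whenever the state is `s`. -/
def stationary (f : State → Bool) : Policy := fun _ s => PMF.pure (f s)

/-- The joint law of the past state-action pairs `(S(t-1), a(t-1)), …, (S(0), a(0))` and of the
state `S(t)`, when `S(0)` has law `μ` and the policy `π` is used. -/
def law (p q : I) (μ : PMF State) (π : Policy) : ℕ → PMF (List (State × Bool) × State)
  | 0 => μ.map fun s => ([], s)
  | t + 1 => (law p q μ π t).bind fun w => (π w.1 w.2).bind fun a =>
      (step p q w.2 a).map fun s' => ((w.2, a) :: w.1, s')

/-- The cost of one slot: the age plus the storage cost. -/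
def cost (c : ℝ≥0) (x : State × Bool) : ℝ≥0∞ :=
  ((x.1.age : ℕ) : ℝ≥0∞) + (if x.2 then (c : ℝ≥0∞) else 0)

/-- The expected total cost `E_π[∑_{t=0}^{T-1} (v(t) + c(t))]` over the slots `0, …, T - 1`. -/
def expectedCost (p q : I) (c : ℝ≥0) (μ : PMF State) (π : Policy) (T : ℕ) : ℝ≥0∞ :=
  ∑' w : List (State × Bool) × State, law p q μ π T w * (w.1.map (cost c)).sum

/-- The long-run average expected cost `limsup_{T → ∞} (1 / T) E_π[∑_{t=0}^{T-1} (v(t) + c(t))]`. -/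
def averageCost (p q : I) (c : ℝ≥0) (μ : PMF State) (π : Policy) : ℝ≥0∞ :=
  Filter.limsup (fun T : ℕ => expectedCost p q c μ π T / (T : ℝ≥0∞)) Filter.atTop

/-- The mean age under a law on the states. -/
def meanAge (μ : PMF State) : ℝ≥0∞ := ∑' s : State, μ s * ((s.age : ℕ) : ℝ≥0∞)

end AgeStorage

end

noncomputable section

namespace AgeStorage

open Filter

/-! ### Expectations of extended nonnegative functions -/

/-! The average cost optimality equation `g + h s = min_a (cost + E h)` is solved explicitly, by
renewal. The age returns to one exactly when a fresh packet gets through. This event does not depend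
on the actions, and after it the buffer is irrelevant (`cycleValue_age_one`). Hence it suffices to
minimize the cost of one cycle. Let `V` be that minimal cost (`cycleValue`, a least fixed point) and
`K` its mean at a reset. A reset occurs at rate `p * q`, so `g = p * q * K`. The usual relative
value is `V` minus `g` times the mean time to reset; up to a constant this is `V + q * K` on fresh
states and `V` on the others, which avoids subtraction in `ℝ≥0∞`.

Telescoping the equation bounds every policy from below and the greedy policy from above
(`le_expectedCost_add`, `expectedCost_stationary_le`). Boundary terms vanish after division by `T`
if `E h(S_T)` is bounded in `T`. A single Lyapunov function, `weight`, gives this bound under every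
policy and also the finiteness of `V`. -/

/-- The expectation of `φ` under `μ`. -/
def expect {α : Type*} (μ : PMF α) (φ : α → ℝ≥0∞) : ℝ≥0∞ := ∑' a, μ a * φ a

section Expect

variable {α β : Type*}

lemma expect_mono (μ : PMF α) {φ ψ : α → ℝ≥0∞} (h : ∀ a, φ a ≤ ψ a) :
    expect μ φ ≤ expect μ ψ :=
  ENNReal.tsum_le_tsum fun a => mul_le_mul_right (h a) _

lemma expect_add (μ : PMF α) (φ ψ : α → ℝ≥0∞) :
    expect μ (fun a => φ a + ψ a) = expect μ φ + expect μ ψ := by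
  simp only [expect, mul_add, ENNReal.tsum_add]

lemma expect_const (μ : PMF α) (k : ℝ≥0∞) : expect μ (fun _ => k) = k := by
  simp only [expect, ENNReal.tsum_mul_right, PMF.tsum_coe, one_mul]

lemma expect_const_mul (μ : PMF α) (k : ℝ≥0∞) (φ : α → ℝ≥0∞) :
    expect μ (fun a => k * φ a) = k * expect μ φ := by
  simp only [expect, mul_left_comm _ k, ENNReal.tsum_mul_left]

lemma expect_pure (a : α) (φ : α → ℝ≥0∞) : expect (PMF.pure a) φ = φ a := by
  rw [expect, tsum_eq_single a]
  · simp
  · intro b hb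
    simp [PMF.pure_apply, hb]

lemma expect_bind (μ : PMF α) (k : α → PMF β) (φ : β → ℝ≥0∞) :
    expect (μ.bind k) φ = expect μ fun a => expect (k a) φ := by
  simp only [expect, PMF.bind_apply, ← ENNReal.tsum_mul_right, ← ENNReal.tsum_mul_left]
  rw [ENNReal.tsum_comm]
  simp only [mul_assoc]

lemma expect_map (μ : PMF α) (k : α → β) (φ : β → ℝ≥0∞) :
    expect (μ.map k) φ = expect μ fun a => φ (k a) := by
  simp only [PMF.map, expect_bind, Function.comp_apply, expect_pure]

end Expect

lemma expect_coin (p : I) (φ : Bool → ℝ≥0∞) :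
    expect (coin p) φ = ENNReal.ofReal p * φ true + ENNReal.ofReal (1 - p) * φ false := by
  simp [expect, coin, tsum_fintype]

lemma ofReal_add_ofReal_symm (p : I) : ENNReal.ofReal p + ENNReal.ofReal (1 - p) = 1 := by
  rw [← ENNReal.ofReal_add p.2.1 (sub_nonneg.2 p.2.2), add_sub_cancel, ENNReal.ofReal_one]

lemma expect_step (p q : I) (s : State) (a : Bool) (φ : State → ℝ≥0∞) :
    expect (step p q s a) φ =
      ENNReal.ofReal q * (ENNReal.ofReal p * φ (next s a true true)
        + ENNReal.ofReal (1 - p) * φ (next s a true false))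
      + ENNReal.ofReal (1 - q) * (ENNReal.ofReal p * φ (next s a false true)
        + ENNReal.ofReal (1 - p) * φ (next s a false false)) := by
  simp only [step, expect_bind, expect_map, expect_coin]

/-! ### The total cost along a policy -/

/-- The total cost of a history. -/
def pathCost (c : ℝ≥0) (l : List (State × Bool)) : ℝ≥0∞ := (l.map (cost c)).sum

lemma expectedCost_eq_expect (p q : I) (c : ℝ≥0) (μ : PMF State) (π : Policy) (T : ℕ) :
    expectedCost p q c μ π T = expect (law p q μ π T) fun w => pathCost c w.1 := rfl

lemma expect_law_succ (p q : I) (μ : PMF State) (π : Policy) (T : ℕ) (φ : State → ℝ≥0∞) :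
    expect (law p q μ π (T + 1)) (fun w => φ w.2) =
      expect (law p q μ π T) fun w => expect (π w.1 w.2) fun a => expect (step p q w.2 a) φ := by
  simp only [law, expect_bind, expect_map]

lemma expect_pathCost_succ (p q : I) (c : ℝ≥0) (μ : PMF State) (π : Policy) (T : ℕ)
    (φ : State → ℝ≥0∞) :
    expect (law p q μ π (T + 1)) (fun w => pathCost c w.1 + φ w.2) =
      expect (law p q μ π T) fun w => pathCost c w.1 +
        expect (π w.1 w.2) fun a => cost c (w.2, a) + expect (step p q w.2 a) φ := by
  simp only [law, expect_bind, expect_map, pathCost, List.map_cons, List.sum_cons, expect_add,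
    expect_const]
  ring

lemma expect_law_zero (p q : I) (c : ℝ≥0) (μ : PMF State) (π : Policy) (φ : State → ℝ≥0∞) :
    expect (law p q μ π 0) (fun w => pathCost c w.1 + φ w.2) = expect μ φ := by
  simp [law, expect_map, pathCost]

/-- A subsolution of the average cost optimality equation bounds the cost of every policy
from below. -/
lemma le_expectedCost_add (p q : I) (c : ℝ≥0) (μ : PMF State) (π : Policy) {g : ℝ≥0∞}
    {h : State → ℝ≥0∞}
    (H : ∀ s a, g + h s ≤ cost c (s, a) + expect (step p q s a) h) (T : ℕ) :
    T * g + expect μ h ≤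
      expectedCost p q c μ π T + expect (law p q μ π T) fun w => h w.2 := by
  rw [expectedCost_eq_expect, ← expect_add]
  induction T with
  | zero => simp [expect_law_zero]
  | succ T ih =>
    rw [expect_pathCost_succ]
    calc ((T + 1 : ℕ) : ℝ≥0∞) * g + expect μ h = g + (T * g + expect μ h) := by push_cast; ring
      _ ≤ g + expect (law p q μ π T) (fun w => pathCost c w.1 + h w.2) := by gcongr
      _ = expect (law p q μ π T) (fun w => g + (pathCost c w.1 + h w.2)) := by
        rw [expect_add _ (fun _ => g), expect_const]
      _ ≤ _ := expect_mono _ fun w => by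
        rw [add_left_comm]
        gcongr
        rw [← expect_const (π w.1 w.2) (g + h w.2)]
        exact expect_mono _ fun a => H w.2 a

/-- A stationary policy attaining equality in the average cost optimality equation. -/
lemma expectedCost_stationary_le (p q : I) (c : ℝ≥0) (μ : PMF State) (f : State → Bool)
    {g : ℝ≥0∞} {h : State → ℝ≥0∞}
    (H : ∀ s, cost c (s, f s) + expect (step p q s (f s)) h ≤ g + h s) (T : ℕ) :
    expectedCost p q c μ (stationary f) T ≤ T * g + expect μ h := by
  rw [expectedCost_eq_expect]
  refine (expect_mono (ψ := fun w => pathCost c w.1 + h w.2) (law p q μ (stationary f) T)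
    fun w => le_self_add).trans ?_
  induction T with
  | zero => simp [expect_law_zero]
  | succ T ih =>
    rw [expect_pathCost_succ]
    calc _ ≤ expect (law p q μ (stationary f) T) (fun w => g + (pathCost c w.1 + h w.2)) :=
          expect_mono _ fun w => by
            rw [add_left_comm, stationary, expect_pure]
            exact add_le_add_right (H w.2) _
      _ = g + expect (law p q μ (stationary f) T) (fun w => pathCost c w.1 + h w.2) := by
        rw [expect_add _ (fun _ => g), expect_const]
      _ ≤ g + (T * g + expect μ h) := by gcongr
      _ = ((T + 1 : ℕ) : ℝ≥0∞) * g + expect μ h := by push_cast; ring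

/-- A drift condition bounds the expectation of a Lyapunov function uniformly in time. -/
lemma expect_law_le (p q : I) (μ : PMF State) (π : Policy) {W : State → ℝ≥0∞} {r M R : ℝ≥0∞}
    (H : ∀ s a, expect (step p q s a) W ≤ r * W s + M) (h₀ : expect μ W ≤ R)
    (hR : r * R + M ≤ R) (T : ℕ) : expect (law p q μ π T) (fun w => W w.2) ≤ R := by
  induction T with
  | zero => simpa [law, expect_map] using h₀
  | succ T ih =>
    rw [expect_law_succ]
    calc _ ≤ expect (law p q μ π T) (fun w => r * W w.2 + M) := expect_mono _ fun w => by
          rw [← expect_const (π w.1 w.2) (r * W w.2 + M)]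
          exact expect_mono _ fun a => H w.2 a
      _ = r * expect (law p q μ π T) (fun w => W w.2) + M := by
        rw [expect_add _ _ (fun _ => M), expect_const, expect_const_mul]
      _ ≤ r * R + M := by gcongr
      _ ≤ R := hR

/-! ### Averages -/

lemma tendsto_div_natCast_zero {C : ℝ≥0∞} (hC : C ≠ ⊤) :
    Tendsto (fun T : ℕ => C / (T : ℝ≥0∞)) atTop (nhds 0) := by
  simpa using ENNReal.Tendsto.const_div ENNReal.tendsto_nat_nhds_top (Or.inr hC)

lemma limsup_div_le {e : ℕ → ℝ≥0∞} {g C : ℝ≥0∞} (hC : C ≠ ⊤) (h : ∀ T : ℕ, e T ≤ T * g + C) :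
    limsup (fun T : ℕ => e T / (T : ℝ≥0∞)) atTop ≤ g := by
  have hlim : Tendsto (fun T : ℕ => g + C / (T : ℝ≥0∞)) atTop (nhds g) := by
    simpa using (tendsto_div_natCast_zero hC).const_add g
  refine (limsup_le_limsup ?_).trans_eq hlim.limsup_eq
  filter_upwards [eventually_ne_atTop 0] with T hT
  refine (ENNReal.div_le_div_right (h T) _).trans_eq ?_
  rw [ENNReal.add_div, mul_comm, ENNReal.mul_div_cancel_right (by simpa) (by simp)]

lemma le_limsup_div {e : ℕ → ℝ≥0∞} {g C : ℝ≥0∞} (hg : g ≠ ⊤) (hC : C ≠ ⊤)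
    (h : ∀ T : ℕ, T * g ≤ e T + C) :
    g ≤ limsup (fun T : ℕ => e T / (T : ℝ≥0∞)) atTop := by
  have hlim : Tendsto (fun T : ℕ => g - C / (T : ℝ≥0∞)) atTop (nhds g) := by
    simpa using ENNReal.Tendsto.sub tendsto_const_nhds (tendsto_div_natCast_zero hC) (Or.inl hg)
  refine hlim.limsup_eq.symm.trans_le (limsup_le_limsup ?_)
  filter_upwards [eventually_ne_atTop 0] with T hT
  rw [tsub_le_iff_right, ← ENNReal.add_div]
  refine le_trans ?_ (ENNReal.div_le_div_right (h T) _)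
  rw [mul_comm, ENNReal.mul_div_cancel_right (by simpa) (by simp)]

/-! ### The Bellman operator of the process killed on the reset of the age to one -/

/-- The restriction of `φ` to the states of age different from one. -/
def killed (φ : State → ℝ≥0∞) (s : State) : ℝ≥0∞ := if s.age = 1 then 0 else φ s

/-- The cost of action `a` in state `s` when `φ` is the cost to go, which vanishes when the age
is reset to one. -/
def actionValue (p q : I) (c : ℝ≥0) (φ : State → ℝ≥0∞) (s : State) (a : Bool) : ℝ≥0∞ :=
  cost c (s, a) + expect (step p q s a) (killed φ)

/-- The Bellman operator of the killed process. -/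
def bellman (p q : I) (c : ℝ≥0) : (State → ℝ≥0∞) →o (State → ℝ≥0∞) where
  toFun φ s := min (actionValue p q c φ s false) (actionValue p q c φ s true)
  monotone' φ ψ h s := by
    have hk : ∀ a, actionValue p q c φ s a ≤ actionValue p q c ψ s a := fun a =>
      add_le_add_right (expect_mono _ fun s' => by
        unfold killed
        split_ifs
        · exact le_rfl
        · exact h s') _
    exact min_le_min (hk _) (hk _)

/-- The minimal expected cost until the age is reset to one. -/
def cycleValue (p q : I) (c : ℝ≥0) : State → ℝ≥0∞ := (bellman p q c).lfp

lemma cycleValue_eq (p q : I) (c : ℝ≥0) (s : State) :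
    cycleValue p q c s = min (actionValue p q c (cycleValue p q c) s false)
      (actionValue p q c (cycleValue p q c) s true) :=
  (congrFun (bellman p q c).map_lfp s).symm

/-- The action minimizing the cost until the age is reset to one. -/
def greedy (p q : I) (c : ℝ≥0) (s : State) : Bool :=
  open Classical in
  decide (actionValue p q c (cycleValue p q c) s true
    ≤ actionValue p q c (cycleValue p q c) s false)

lemma actionValue_greedy (p q : I) (c : ℝ≥0) (s : State) :
    actionValue p q c (cycleValue p q c) s (greedy p q c s) = cycleValue p q c s := by
  rw [cycleValue_eq, greedy]
  by_cases h : actionValue p q c (cycleValue p q c) s true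
      ≤ actionValue p q c (cycleValue p q c) s false
  · simp [h]
  · simp [h, (not_le.1 h).le]

lemma cycleValue_le_actionValue (p q : I) (c : ℝ≥0) (s : State) (a : Bool) :
    cycleValue p q c s ≤ actionValue p q c (cycleValue p q c) s a := by
  rw [cycleValue_eq]
  cases a
  · exact min_le_left _ _
  · exact min_le_right _ _

/-- At age one the buffer is worthless. -/
lemma cycleValue_age_one (p q : I) (c : ℝ≥0) (l b : Bool) :
    cycleValue p q c ⟨1, l, b⟩ = cycleValue p q c ⟨1, l, false⟩ := by
  -- Delivering the buffered packet gives age 2, which is also the age after a failure.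
  have hn : ∀ a x y, next ⟨1, l, b⟩ a x y = next ⟨1, l, false⟩ a x y := by
    intro a x y
    cases l <;> cases b <;> cases x <;> rfl
  rw [cycleValue_eq, cycleValue_eq p q c ⟨1, l, false⟩]
  simp only [actionValue, step, hn, cost]

/-- The mean cost of a cycle that starts with age one. -/
def resetValue (p q : I) (c : ℝ≥0) : ℝ≥0∞ :=
  ENNReal.ofReal p * cycleValue p q c ⟨1, true, false⟩
    + ENNReal.ofReal (1 - p) * cycleValue p q c ⟨1, false, false⟩

/-- The relative value function. -/
def relValue (p q : I) (c : ℝ≥0) (s : State) : ℝ≥0∞ :=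
  cycleValue p q c s + if s.fresh then ENNReal.ofReal q * resetValue p q c else 0

/-- The optimal average cost. -/
def optCost (p q : I) (c : ℝ≥0) : ℝ≥0∞ :=
  ENNReal.ofReal p * (ENNReal.ofReal q * resetValue p q c)

/-- The age after a slot is one only after a successful transmission of a fresh packet. -/
lemma next_age_eq_one_iff (s : State) (a x y : Bool) :
    (next s a x y).age = 1 ↔ s.fresh = true ∧ x = true := by
  have h2 : (2 : ℕ+) ≠ 1 := by decide
  have h1 : s.age + 1 ≠ 1 := fun h => by
    have := congrArg PNat.val h
    have := s.age.pos
    simp at *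
  cases hs : s.fresh <;> cases x <;> cases hb : s.buf <;> simp [next, hs, hb, h1, h2]

/-- Killing discards only the resets. From a fresh state these have probability `q` under either
action, and their mean continuation value is `resetValue`. -/
lemma expect_step_cycleValue (p q : I) (c : ℝ≥0) (s : State) (a : Bool) :
    expect (step p q s a) (cycleValue p q c) = expect (step p q s a) (killed (cycleValue p q c))
      + if s.fresh then ENNReal.ofReal q * resetValue p q c else 0 := by
  simp only [expect_step, killed, next_age_eq_one_iff]
  cases hs : s.fresh
  · simp
  · have hn : ∀ y, cycleValue p q c (next s a true y) = cycleValue p q c ⟨1, y, false⟩ := by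
      intro y
      rw [← cycleValue_age_one p q c y a]
      simp [next, hs]
    simp only [hn, resetValue, and_self, if_true, Bool.false_eq_true, and_false, if_false]
    ring

/-- The next arrival is a `p`-coin independent of state and action, so the fresh-state bonus in
`relValue` contributes exactly `optCost` in the next slot. -/
lemma expect_step_relValue (p q : I) (c : ℝ≥0) (s : State) (a : Bool) :
    cost c (s, a) + expect (step p q s a) (relValue p q c) =
      actionValue p q c (cycleValue p q c) s a
        + (if s.fresh then ENNReal.ofReal q * resetValue p q c else 0) + optCost p q c := by
  have hfresh : expect (step p q s a)
      (fun s' => if s'.fresh then ENNReal.ofReal q * resetValue p q c else 0)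
      = optCost p q c := by
    simp only [expect_step, next, optCost]
    simp only [if_true, Bool.false_eq_true, if_false, mul_zero, add_zero]
    rw [← add_mul, ofReal_add_ofReal_symm, one_mul]
  unfold relValue actionValue
  rw [expect_add, expect_step_cycleValue, hfresh]
  ring

lemma optCost_add_relValue_le (p q : I) (c : ℝ≥0) (s : State) (a : Bool) :
    optCost p q c + relValue p q c s ≤ cost c (s, a) + expect (step p q s a) (relValue p q c) := by
  rw [expect_step_relValue, add_comm, relValue]
  gcongr
  exact cycleValue_le_actionValue p q c s a

lemma greedy_le (p q : I) (c : ℝ≥0) (s : State) :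
    cost c (s, greedy p q c s) + expect (step p q s (greedy p q c s)) (relValue p q c) ≤
      optCost p q c + relValue p q c s := by
  rw [expect_step_relValue, actionValue_greedy, add_comm (optCost p q c), relValue]

/-! ### The weight function -/

/-- An affine function of the age, larger when there is no fresh packet. -/
def weight (p q : I) (s : State) : ℝ :=
  1 / (p * q ^ 2) * (((s.age : ℕ) : ℝ) + 2 / (p * q ^ 2)) * (if s.fresh then 1 else 1 + (q : ℝ))

lemma weight_nonneg (p q : I) (s : State) : 0 ≤ weight p q s := by
  have := p.2.1
  have := q.2.1
  unfold weight
  split_ifs <;> positivity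

lemma expect_step_ofReal (p q : I) (s : State) (a : Bool) {φ : State → ℝ} (hφ : ∀ s, 0 ≤ φ s) :
    expect (step p q s a) (fun s' => ENNReal.ofReal (φ s')) =
      ENNReal.ofReal (q * (p * φ (next s a true true) + (1 - p) * φ (next s a true false))
        + (1 - q) * (p * φ (next s a false true) + (1 - p) * φ (next s a false false))) := by
  have hp := p.2.1
  have hq := q.2.1
  have hp' := sub_nonneg.2 p.2.2
  have hq' := sub_nonneg.2 q.2.2
  have h : ∀ x, 0 ≤ p * φ (next s a x true) + (1 - p) * φ (next s a x false) := fun x =>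
    add_nonneg (mul_nonneg hp (hφ _)) (mul_nonneg hp' (hφ _))
  rw [expect_step, ENNReal.ofReal_add (mul_nonneg hq (h _)) (mul_nonneg hq' (h _)),
    ENNReal.ofReal_mul hq, ENNReal.ofReal_mul hq']
  simp only [ENNReal.ofReal_add, ENNReal.ofReal_mul, hp, hp', mul_nonneg, hφ]

/-- Survival multiplies the mean factor by at most `(1 - Q) * (1 + Q) = 1 - Q ^ 2`. Since `A * Q ^ 2
≥ 1`, the loss pays for `v`, and the shift `2 * A` pays for the growth of the age. -/
lemma fresh_drift {P Q A v : ℝ} (hP : 0 < P) (hP' : P ≤ 1) (hQ : 0 < Q) (hQ' : Q ≤ 1)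
    (hA : P * Q ^ 2 * A = 1) (hv : 0 ≤ v) :
    v + (1 - Q) * (P * (A * (v + 1 + 2 * A)) + (1 - P) * (A * (v + 1 + 2 * A) * (1 + Q)))
      ≤ A * (v + 2 * A) := by
  have hA0 : 0 < A := pos_of_mul_pos_right (hA ▸ one_pos) (by positivity)
  have h1 : 0 ≤ (1 - Q) * (P * Q) * (A * (v + 1 + 2 * A)) :=
    mul_nonneg (mul_nonneg (sub_nonneg.2 hQ') (by positivity)) (by positivity)
  have h2 : P * (A * Q ^ 2) ≤ 1 * (A * Q ^ 2) := mul_le_mul_of_nonneg_right hP' (by positivity)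
  have h3 : 0 ≤ (A * Q ^ 2 - 1) * (v + 1 + 2 * A) :=
    mul_nonneg (by linarith) (by positivity)
  linarith

/-- The chance `P` of an arrival lowers the mean factor by `P * Q`, and `P * Q * A ≥ 1`. The growth
of the age costs `A * (1 + Q) ≤ 2 * A`, covered by the shift. -/
lemma stale_drift {P Q A v x : ℝ} (hP : 0 < P) (hP' : P ≤ 1) (hQ : 0 < Q) (hQ' : Q ≤ 1)
    (hA : P * Q ^ 2 * A = 1) (hv : 0 ≤ v) (hx : x ≤ v + 1) :
    v + (P * (A * (x + 2 * A)) + (1 - P) * (A * (x + 2 * A) * (1 + Q)))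
      ≤ A * (v + 2 * A) * (1 + Q) := by
  have hA0 : 0 < A := pos_of_mul_pos_right (hA ▸ one_pos) (by positivity)
  have h1 : 0 ≤ (P + (1 - P) * (1 + Q)) * A * (v + 1 - x) :=
    mul_nonneg (mul_nonneg (add_nonneg hP.le (mul_nonneg (sub_nonneg.2 hP') (by positivity)))
      hA0.le) (by linarith)
  have h2 : Q * (P * Q * A) ≤ 1 * (P * Q * A) := mul_le_mul_of_nonneg_right hQ' (by positivity)
  have h3 : 0 ≤ (P * Q * A - 1) * (v + 1 + 2 * A) := mul_nonneg (by linarith) (by positivity)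
  have h4 : A * Q ≤ A * 1 := mul_le_mul_of_nonneg_left hQ' hA0.le
  linarith

/-- The drift of the weight function of the killed process. -/
lemma expect_step_killed_weight_le (p q : I) (hp : 0 < p) (hq : 0 < q) (s : State) (a : Bool) :
    ((s.age : ℕ) : ℝ≥0∞)
      + expect (step p q s a) (killed fun s' => ENNReal.ofReal (weight p q s'))
      ≤ ENNReal.ofReal (weight p q s) := by
  have hp0 : (0 : ℝ) < p := hp
  have hq0 : (0 : ℝ) < q := hq
  have hp1 := p.2.2
  have hq1 := q.2.2
  let φ : State → ℝ := fun s' => if s'.age = 1 then 0 else weight p q s'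
  have hφ : ∀ s', 0 ≤ φ s' := fun s' => by
    dsimp only [φ]
    split_ifs
    · exact le_rfl
    · exact weight_nonneg p q s'
  have hk : (killed fun s' => ENNReal.ofReal (weight p q s')) = fun s' => ENNReal.ofReal (φ s') := by
    funext s'
    simp only [killed, φ]
    split_ifs <;> simp
  have hv : (1 : ℝ) ≤ ((s.age : ℕ) : ℝ) := by exact_mod_cast s.age.pos
  rw [hk, expect_step_ofReal p q s a hφ, ← ENNReal.ofReal_natCast, ← ENNReal.ofReal_add (by linarith)]
  · refine ENNReal.ofReal_le_ofReal ?_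
    simp only [φ, next_age_eq_one_iff, weight]
    obtain ⟨A, hAdef⟩ : ∃ A : ℝ, A = 1 / (p * q ^ 2) := ⟨_, rfl⟩
    have hA : (p : ℝ) * q ^ 2 * A = 1 := by rw [hAdef]; field_simp
    have hB : (2 : ℝ) / (p * q ^ 2) = 2 * A := by rw [hAdef]; ring
    rw [hB, ← hAdef]
    cases hs : s.fresh
    · have h1 := stale_drift hp0 hp1 hq0 hq1 hA (by linarith) (le_refl (((s.age : ℕ) : ℝ) + 1))
      cases hb : s.buf
      · simp [next, hs, hb]
        linarith
      -- With a buffered packet the next age is 2 on success and `v + 1` on failure, so the two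
      -- drift bounds are averaged with weights `q` and `1 - q`.
      · have h2 := stale_drift hp0 hp1 hq0 hq1 hA (zero_le_one.trans hv)
          (x := 2) (by linarith)
        simp [next, hs, hb]
        have h3 := mul_le_mul_of_nonneg_left h1 (sub_nonneg.2 hq1)
        have h4 := mul_le_mul_of_nonneg_left h2 hq0.le
        linarith
    · have h1 := fresh_drift hp0 hp1 hq0 hq1 hA (v := ((s.age : ℕ) : ℝ)) (by linarith)
      simp [next, hs]
      linarith
  · have h : ∀ x, 0 ≤ p * φ (next s a x true) + (1 - p) * φ (next s a x false) := fun x =>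
      add_nonneg (mul_nonneg hp0.le (hφ _)) (mul_nonneg (sub_nonneg.2 hp1) (hφ _))
    exact add_nonneg (mul_nonneg hq0.le (h _)) (mul_nonneg (sub_nonneg.2 hq1) (h _))

/-- The least fixed point lies below every supersolution; never storing costs only the age, so the
drift inequality makes `weight` one. -/
lemma cycleValue_le_weight (p q : I) (hp : 0 < p) (hq : 0 < q) (c : ℝ≥0) (s : State) :
    cycleValue p q c s ≤ ENNReal.ofReal (weight p q s) := by
  refine (bellman p q c).lfp_le (a := fun s => ENNReal.ofReal (weight p q s)) (fun s => ?_) s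
  refine (min_le_left _ _).trans ?_
  simpa [actionValue, cost] using expect_step_killed_weight_le p q hp hq s false

/-- The weight grows at most linearly in the age. -/
lemma exists_weight_le_mul_age (p q : I) : ∃ D : ℝ≥0, 1 ≤ D ∧ ∀ s,
    ENNReal.ofReal (weight p q s) ≤ D * ((s.age : ℕ) : ℝ≥0∞) := by
  have hp := p.2.1
  have hq := q.2.1
  set A : ℝ := 1 / (p * q ^ 2) with hA
  have hA0 : 0 ≤ A := by positivity
  have hB : (2 : ℝ) / (p * q ^ 2) = 2 * A := by rw [hA]; ring
  have hD : 0 ≤ 1 + A * (1 + 2 * A) * (1 + q) := by positivity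
  -- The extra summand 1 ensures `D⁻¹ ≤ 1`, so that `1 - D⁻¹` is a true contraction factor.
  refine ⟨(1 + A * (1 + 2 * A) * (1 + q)).toNNReal, ?_, fun s => ?_⟩
  · rw [Real.one_le_toNNReal]
    linarith [show 0 ≤ A * (1 + 2 * A) * (1 + (q : ℝ)) by positivity]
  · have hv : (1 : ℝ) ≤ ((s.age : ℕ) : ℝ) := by exact_mod_cast s.age.pos
    change _ ≤ ENNReal.ofReal _ * _
    rw [← ENNReal.ofReal_natCast, ← ENNReal.ofReal_mul hD]
    refine ENNReal.ofReal_le_ofReal ?_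
    rw [weight, hB, ← hA]
    calc A * (((s.age : ℕ) : ℝ) + 2 * A) * (if s.fresh then 1 else 1 + (q : ℝ))
        ≤ A * (((s.age : ℕ) : ℝ) + 2 * A * ((s.age : ℕ) : ℝ)) * (1 + q) := by
          have h1 : 2 * A ≤ 2 * A * ((s.age : ℕ) : ℝ) := le_mul_of_one_le_right (by positivity) hv
          have h2 : (if s.fresh then 1 else 1 + (q : ℝ)) ≤ 1 + q := by split_ifs <;> linarith
          gcongr
      _ = A * (1 + 2 * A) * (1 + q) * ((s.age : ℕ) : ℝ) := by ring
      _ ≤ _ := by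
          gcongr
          linarith

/-- The mean weight stays bounded in time under every policy. -/
lemma exists_expect_law_weight_le (p q : I) (hp : 0 < p) (hq : 0 < q) (μ : PMF State)
    (hμ : meanAge μ < ⊤) : ∃ R : ℝ≥0∞, R ≠ ⊤ ∧ ∀ (π : Policy) (T : ℕ),
      expect (law p q μ π T) (fun w => ENNReal.ofReal (weight p q w.2)) ≤ R := by
  obtain ⟨D, hD1, hD⟩ := exists_weight_le_mul_age p q
  have hD0 : (D : ℝ≥0∞) ≠ 0 := by
    rw [Ne, ENNReal.coe_eq_zero]
    exact (zero_lt_one.trans_le hD1).ne'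
  have hDi : (D : ℝ≥0∞)⁻¹ ≤ 1 := ENNReal.inv_le_one.2 (by exact_mod_cast hD1)
  set W : State → ℝ≥0∞ := fun s => ENNReal.ofReal (weight p q s) with hW
  have hμW : expect μ W ≤ D * meanAge μ :=
    (expect_mono μ hD).trans_eq (expect_const_mul μ _ _)
  have hsplit : ∀ x : ℝ≥0∞, (D : ℝ≥0∞)⁻¹ * x + (1 - (D : ℝ≥0∞)⁻¹) * x = x := fun x => by
    rw [← add_mul, add_tsub_cancel_of_le hDi, one_mul]
  have hdrift : ∀ s a, expect (step p q s a) W ≤ (1 - (D : ℝ≥0∞)⁻¹) * W s + D := by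
    intro s a
    have hfin : (D : ℝ≥0∞)⁻¹ * W s ≠ ⊤ :=
      ENNReal.mul_ne_top (ENNReal.inv_ne_top.2 hD0) ENNReal.ofReal_ne_top
    refine (ENNReal.add_le_add_iff_left hfin).1 ?_
    rw [← add_assoc, hsplit]
    have h1 : (D : ℝ≥0∞)⁻¹ * W s ≤ ((s.age : ℕ) : ℝ≥0∞) := by
      rw [mul_comm]
      exact ENNReal.div_le_of_le_mul' (hD s)
    -- At age one the weight is at most `D`, so restoring the killed part costs at most `D`.
    have h2 : expect (step p q s a) W ≤ expect (step p q s a) (killed W) + D := by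
      rw [← expect_const (step p q s a) D, ← expect_add]
      refine expect_mono _ fun s' => ?_
      unfold killed
      split_ifs with h
      · have := hD s'
        rw [h, PNat.one_coe, Nat.cast_one, mul_one] at this
        rwa [zero_add]
      · exact le_self_add
    calc _ ≤ ((s.age : ℕ) : ℝ≥0∞) + (expect (step p q s a) (killed W) + D) := by gcongr
      _ ≤ W s + D := by
        rw [← add_assoc]
        gcongr
        exact expect_step_killed_weight_le p q hp hq s a
  -- `D * meanAge μ` dominates the initial mean; `D * D` is the fixed point of `R ↦ (1 - D⁻¹) * R +
  -- D`.
  refine ⟨D * meanAge μ + D * D, by finiteness, fun π T =>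
    expect_law_le p q μ π hdrift (hμW.trans le_self_add) ?_ T⟩
  conv_rhs => rw [← hsplit (D * meanAge μ + D * D), add_comm]
  gcongr
  rw [mul_add, ← mul_assoc _ (D : ℝ≥0∞) (D : ℝ≥0∞), ENNReal.inv_mul_cancel hD0 ENNReal.coe_ne_top,
    one_mul]
  exact le_add_self

lemma resetValue_ne_top (p q : I) (hp : 0 < p) (hq : 0 < q) (c : ℝ≥0) : resetValue p q c ≠ ⊤ := by
  have h : ∀ s, cycleValue p q c s ≠ ⊤ := fun s =>
    ne_top_of_le_ne_top ENNReal.ofReal_ne_top (cycleValue_le_weight p q hp hq c s)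
  have h1 := h ⟨1, true, false⟩
  have h2 := h ⟨1, false, false⟩
  unfold resetValue
  finiteness

lemma relValue_le (p q : I) (hp : 0 < p) (hq : 0 < q) (c : ℝ≥0) (s : State) :
    relValue p q c s ≤ ENNReal.ofReal (weight p q s) + ENNReal.ofReal q * resetValue p q c := by
  unfold relValue
  gcongr
  · exact cycleValue_le_weight p q hp hq c s
  · split_ifs
    · exact le_rfl
    · exact zero_le

end AgeStorage

end

theorem theorem1 (p q : unitInterval) (hp₀ : 0 < p) (hp₁ : p < 1) (hq₀ : 0 < q) (hq₁ : q < 1)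
    (c : NNReal) :
    ∃ f : AgeStorage.State → Bool,
      ∀ μ : PMF AgeStorage.State, AgeStorage.meanAge μ < ⊤ →
        AgeStorage.averageCost p q c μ (AgeStorage.stationary f) < ⊤ ∧
        ∀ π : AgeStorage.Policy,
          AgeStorage.averageCost p q c μ (AgeStorage.stationary f)
            ≤ AgeStorage.averageCost p q c μ π := by
  open AgeStorage in
  refine ⟨greedy p q c, fun μ hμ => ?_⟩
  have hK := resetValue_ne_top p q hp₀ hq₀ c
  have hg : optCost p q c ≠ ⊤ := by
    unfold optCost
    finiteness
  obtain ⟨R, hR, hW⟩ := exists_expect_law_weight_le p q hp₀ hq₀ μ hμ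
  have hC : R + ENNReal.ofReal q * resetValue p q c ≠ ⊤ := by finiteness
  have hrel : ∀ π T, expect (law p q μ π T) (fun w => relValue p q c w.2)
      ≤ R + ENNReal.ofReal q * resetValue p q c := fun π T => by
    have h := expect_mono (law p q μ π T) fun w => relValue_le p q hp₀ hq₀ c w.2
    rw [expect_add, expect_const] at h
    exact h.trans (add_le_add_left (hW π T) _)
  have h₀ : expect μ (relValue p q c) ≠ ⊤ := by
    have h := hrel (stationary (greedy p q c)) 0
    simp only [law, expect_map] at h
    exact ne_top_of_le_ne_top hC h
  have hopt : averageCost p q c μ (stationary (greedy p q c)) ≤ optCost p q c :=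
    limsup_div_le h₀ (expectedCost_stationary_le p q c μ _ (greedy_le p q c))
  refine ⟨hopt.trans_lt hg.lt_top, fun π => hopt.trans (le_limsup_div hg hC fun T => ?_)⟩
  exact le_self_add.trans ((le_expectedCost_add p q c μ π (optCost_add_relValue_le p q c) T).trans
    (by gcongr; exact hrel π T))
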